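/- Throughout, smooth means $C^2$ and $\langle\cdot,\cdot\rangle$ is the Euclidean inner product. A subset of a manifold is an immersed submanifold if it carries the structure of a smooth (second countable) manifold for which the inclusion is a smooth immersion. Identify the tangent bundle of the unit sphere $\mathbb{S}^n\subset\mathbb{R}^{n+1}$ with $$T\mathbb{S}^n=\{(\xi,\eta)\in\mathbb{R}^{n+1}\times\mathbb{R}^{n+1} : \|\xi\|=1,\ \langle\xi,\eta\rangle=0\},$$ where $(\xi,\eta)$ represents the oriented line $\{\eta+t\xi : t\in\mathbb{R}\}$, and let $\Omega=-\mathrm{d}\theta$ be its canonical symplectic form, where $\theta_{(\xi,\eta)}(X)=\langle \mathrm{d}\pi(X),\eta\rangle$ and $\pi(\xi,\eta)=\xi$. An immersed submanifold $\Gamma\subset T\mathbb{S}^n$ is isotropic if $\Omega|_\Gamma=0$. Let $S\subset\mathbb{R}^{n+1}$ be an immersed submanifold with the induced metric and its Levi-Civita connection $\nabla$, let $v$ be a smooth unit tangent vector field on $S$, and define $$\Phi_v:S\to T\mathbb{S}^n,\qquad \Phi_v(p)=\big(v(p),\,p-\langle v(p),p\rangle v(p)\big),$$ which sends $p$ to the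 oriented line through $p$ in direction $v(p)$. Suppose that $\Phi_v$ is an immersion and that $\Phi_v(S)\subset T\mathbb{S}^n$ is an immersed submanifold. Then the following are equivalent. (a) $\Phi_v(S)$ is isotropic. (b) Each $p\in S$ belongs to an open set $U\subseteq S$ on which $v|_U=\operatorname{grad} f$ for some smooth function $f:U\to\mathbb{R}$; if $S$ is simply connected, one may take $U=S$. (c) The distribution $v^\perp:p\mapsto\{X\in T_pS : \langle X,v(p)\rangle=0\}$ is integrable (through each point of $S$ there passes an immersed submanifold of $S$ whose tangent space at each of its points is $v^\perp$), and $v$ is a geodesic vector field on $S$, that is, $\nabla_v v=0$. -/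

import Mathlib

open Set
open scoped Manifold ContDiff

/-- Euclidean space of dimension `m`. -/
abbrev Euc (m : ℕ) : Type := EuclideanSpace ℝ (Fin m)

/-- The tangent bundle of the unit sphere `𝕊ⁿ ⊂ ℝⁿ⁺¹`, as the embedded submanifold of
`ℝⁿ⁺¹ × ℝⁿ⁺¹` of all `(ξ, η)` with `‖ξ‖ = 1` and `⟪ξ, η⟫ = 0`. The point `(ξ, η)` stands for the
oriented line `{η + t ξ}`. -/
def TSphere (n : ℕ) : Set (Euc (n + 1) × Euc (n + 1)) :=
  {z | ‖z.1‖ = 1 ∧ inner ℝ z.1 z.2 = 0}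

/-- The Liouville form `θ_(ξ,η)(X) = ⟪dπ X, η⟫`, where `π (ξ, η) = ξ`. The formula makes sense on
all of `ℝⁿ⁺¹ × ℝⁿ⁺¹`. -/
noncomputable def liouvilleForm (n : ℕ) (z : Euc (n + 1) × Euc (n + 1)) :
    (Euc (n + 1) × Euc (n + 1)) [⋀^Fin 1]→L[ℝ] ℝ :=
  ContinuousAlternatingMap.ofSubsingleton ℝ (Euc (n + 1) × Euc (n + 1)) ℝ (0 : Fin 1)
    ((innerSL ℝ z.2).comp (ContinuousLinearMap.fst ℝ (Euc (n + 1)) (Euc (n + 1))))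

/-- The two-form `Ω = -dθ`. Exterior derivatives commute with restriction, so on vectors tangent to
`TSphere n` this is the canonical symplectic form of `T𝕊ⁿ`. -/
noncomputable def symplecticForm (n : ℕ) (z : Euc (n + 1) × Euc (n + 1)) :
    (Euc (n + 1) × Euc (n + 1)) [⋀^Fin 2]→L[ℝ] ℝ :=
  -extDeriv (liouvilleForm n) z

theorem symplecticForm_apply (n : ℕ) (z X Y : Euc (n + 1) × Euc (n + 1)) :
    symplecticForm n z ![X, Y] = inner ℝ X.1 Y.2 - inner ℝ Y.1 X.2 := by
  have hd : DifferentiableAt ℝ (liouvilleForm n) z := by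
    have h : DifferentiableAt ℝ (fun z : Euc (n + 1) × Euc (n + 1) => (innerSL ℝ z.2).comp
        (ContinuousLinearMap.fst ℝ (Euc (n + 1)) (Euc (n + 1)))) z := by
      have h2 : DifferentiableAt ℝ (fun z : Euc (n + 1) × Euc (n + 1) => innerSL ℝ z.2) z :=
        (innerSL ℝ).differentiableAt.comp z differentiableAt_snd
      exact h2.clm_comp (differentiableAt_const _)
    exact (ContinuousAlternatingMap.ofSubsingletonLIE (𝕜 := ℝ) (E := Euc (n + 1) × Euc (n + 1))
      (F := ℝ) (0 : Fin 1)).toContinuousLinearEquiv.differentiableAt.comp z h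
  have hf : ∀ (w : Fin 1 → Euc (n + 1) × Euc (n + 1)) (y : Euc (n + 1) × Euc (n + 1)),
      fderiv ℝ (fun z => liouvilleForm n z w) z y = inner ℝ (w 0).1 y.2 := by
    intro w y
    have h : (fun z => liouvilleForm n z w) =
        ((innerSL ℝ (w 0).1).comp (ContinuousLinearMap.snd ℝ (Euc (n + 1)) (Euc (n + 1)))) := by
      funext z
      simp [liouvilleForm, real_inner_comm]
    rw [h, ContinuousLinearMap.fderiv]
    simp
  rw [symplecticForm, ContinuousAlternatingMap.neg_apply, extDeriv_apply hd, Fin.sum_univ_two,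
    hf, hf]
  simp [Fin.removeNth, sub_eq_add_neg]

section Immersions

variable {E H M E' H' M' : Type*}
  [NormedAddCommGroup E] [NormedSpace ℝ E] [TopologicalSpace H]
  [TopologicalSpace M] [ChartedSpace H M]
  [NormedAddCommGroup E'] [NormedSpace ℝ E'] [TopologicalSpace H']
  [TopologicalSpace M'] [ChartedSpace H' M']

/-- A `C²` immersion (of finite-dimensional manifolds): a `C²` map with injective differentials. -/
structure IsC2Immersion (I : ModelWithCorners ℝ E H) (I' : ModelWithCorners ℝ E' H')
    (f : M → M') : Prop where
  contMDiff : ContMDiff I I' 2 f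
  injective_mfderiv : ∀ p : M, Function.Injective (mfderiv I I' f p)

/-- `f` exhibits the manifold `M` as an immersed submanifold of `M'`: the set `range f`, with the
manifold structure carried over from `M`, includes in `M'` by a `C²` immersion. -/
structure IsImmersedSubmanifold (I : ModelWithCorners ℝ E H) (I' : ModelWithCorners ℝ E' H')
    (f : M → M') : Prop extends IsC2Immersion I I' f where
  injective : Function.Injective f

end Immersions

/-- `Ω` vanishes on the immersed submanifold `j : N → T𝕊ⁿ`. -/
def IsIsotropic {n : ℕ} {N : Type*} [TopologicalSpace N] (m : ℕ) [ChartedSpace (Euc m) N]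
    (j : N → TSphere n) : Prop :=
  ∀ (q : N) (X Y : TangentSpace (𝓡 m) q),
    symplecticForm n (j q)
      ![mfderiv (𝓡 m) 𝓘(ℝ, Euc (n + 1) × Euc (n + 1))
          (fun x => (j x : Euc (n + 1) × Euc (n + 1))) q X,
        mfderiv (𝓡 m) 𝓘(ℝ, Euc (n + 1) × Euc (n + 1))
          (fun x => (j x : Euc (n + 1) × Euc (n + 1))) q Y] = 0

section Submanifold

variable {n : ℕ} {M : Type*} [TopologicalSpace M]

/-- The differential of a map `g : M → ℝⁿ⁺¹`, with values in `ℝⁿ⁺¹` itself. For a section `g` of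
`Tℝⁿ⁺¹` over `M`, this is the flat derivative of `g` in directions tangent to `M`. -/
noncomputable def dEuc (k : ℕ) [ChartedSpace (Euc k) M] (g : M → Euc (n + 1)) (p : M) :
    TangentSpace (𝓡 k) p →L[ℝ] Euc (n + 1) :=
  mfderiv (𝓡 k) 𝓘(ℝ, Euc (n + 1)) g p

/-- The tangent space at `p` of the submanifold `ι : M → ℝⁿ⁺¹`, as a subspace of `ℝⁿ⁺¹`. -/
noncomputable def tangentPlane (k : ℕ) [ChartedSpace (Euc k) M] (ι : M → Euc (n + 1)) (p : M) : Submodule ℝ (Euc (n + 1)) :=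
  LinearMap.range (dEuc k ι p).toLinearMap

/-- A `C²` unit tangent vector field along the submanifold `ι : M → ℝⁿ⁺¹`. -/
structure UnitTangentField (k : ℕ) [ChartedSpace (Euc k) M] (ι : M → Euc (n + 1)) where
  toFun : M → Euc (n + 1)
  contMDiff : ContMDiff (𝓡 k) 𝓘(ℝ, Euc (n + 1)) 2 toFun
  tangent : ∀ p, toFun p ∈ tangentPlane k ι p
  norm_eq_one : ∀ p, ‖toFun p‖ = 1

namespace UnitTangentField

variable {k : ℕ} [ChartedSpace (Euc k) M] {ι : M → Euc (n + 1)} (v : UnitTangentField k ι)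

/-- The map `Φ_v` from the submanifold to `T𝕊ⁿ`, sending `p` to the oriented line through `p` in
direction `v p`. -/
noncomputable def lineMap (p : M) : TSphere n :=
  ⟨(v.toFun p, ι p - (inner ℝ (v.toFun p) (ι p) : ℝ) • v.toFun p), v.norm_eq_one p, by
    rw [inner_sub_right, inner_smul_right, real_inner_self_eq_norm_sq, v.norm_eq_one p]
    ring⟩

/-- On `U`, `f` is `C²` and `v` is the gradient of `f` for the induced metric on the
submanifold. -/
def IsGradientOn (f : M → ℝ) (U : Set M) : Prop :=
  ContMDiffOn (𝓡 k) 𝓘(ℝ, ℝ) 2 f U ∧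
    ∀ p ∈ U, ∀ X : TangentSpace (𝓡 k) p,
      (mfderiv (𝓡 k) 𝓘(ℝ, ℝ) f p X : ℝ) = inner ℝ (v.toFun p) (dEuc k ι p X)

/-- The distribution `v^⊥` on the submanifold. -/
noncomputable def perp (p : M) : Submodule ℝ (TangentSpace (𝓡 k) p) :=
  LinearMap.ker ((innerSL ℝ (v.toFun p)).comp (dEuc k ι p)).toLinearMap

/-- `v^⊥` is integrable: through every point there is an integral manifold, that is, an immersed
submanifold of `M` whose tangent space at each of its points is `v^⊥`. -/
def PerpIntegrable : Prop :=
  ∀ p : M, ∃ (d : ℕ) (L : Type) (_ : TopologicalSpace L) (_ : SecondCountableTopology L)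
    (_ : ChartedSpace (Euc d) L) (_ : IsManifold (𝓡 d) 2 L) (i : L → M),
    IsImmersedSubmanifold (𝓡 d) (𝓡 k) i ∧ p ∈ range i ∧
      ∀ q : L, LinearMap.range (mfderiv (𝓡 d) (𝓡 k) i q).toLinearMap = v.perp (i q)

/-- The covariant derivative `∇_X v` for the Levi-Civita connection of the induced metric: the
tangential part of the flat derivative. -/
noncomputable def covDeriv (p : M) (X : TangentSpace (𝓡 k) p) : Euc (n + 1) :=
  (tangentPlane k ι p).starProjection (dEuc k v.toFun p X)

/-- `v` is a geodesic vector field on the submanifold: `∇_v v = 0`. -/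
def IsGeodesic : Prop :=
  ∀ (p : M) (V : TangentSpace (𝓡 k) p), dEuc k ι p V = v.toFun p → v.covDeriv p V = 0

end UnitTangentField

end Submanifold

/-! All three conditions say that the one-form `⟪v, dι⟫`, dual to `v` in the induced metric, is
closed. Since `d⟪v, dι⟫ (X, Y) = ⟪dv X, dι Y⟫ - ⟪dv Y, dι X⟫`, this means that `⟪dv X, dι Y⟫` is
symmetric; it is `IsCurlFree`, the hub of the proof.

Isotropy: `⟪v, dv⟫ = 0` makes the pullback of `Ω` under `Φ_v` equal to this two-form
(`stdSymp_fderiv_line`). The manifold structure `j` on the image is related to `Φ_v` only through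
having the same range, so the vanishing of `Ω` is carried between the two immersions by a Baire
category argument (`pullback_eq_zero_of_range_subset`).

Gradients: the Poincaré lemma in a chart ball gives local potentials, and symmetry of second
derivatives gives the converse. Local potentials differ by locally constant functions, so on a
simply connected manifold they glue (`exists_glue_of_simplyConnected`).

Foliation: level sets of a local potential integrate `v^⊥`. Conversely, `⟪v, dι⟫` pulls back to zero
on integral manifolds, which gives symmetry on `v^⊥`; the mixed terms vanish because `v` is geodesic
and has unit length (`isCurlFree_of_perpIntegrable`). -/

open Filter Topology

/-! ### Derivatives in charts -/

section Charts

variable {k : ℕ} {M : Type*} [TopologicalSpace M] [ChartedSpace (Euc k) M] [IsManifold (𝓡 k) 2 M]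
  {F : Type*} [NormedAddCommGroup F] [NormedSpace ℝ F]

theorem mdifferentiable_chart_two (p : M) :
    (chartAt (Euc k) p).MDifferentiable (𝓡 k) (𝓡 k) :=
  have : IsManifold (𝓡 k) 1 M := .of_le (n := 2) (by norm_num)
  mdifferentiable_chart p

/-- The representative in the preferred chart at `p₀`. -/
abbrev inChart (p₀ : M) (g : M → F) : Euc k → F := g ∘ (chartAt (Euc k) p₀).symm

theorem mfderiv_eq_fderiv_inChart {g : M → F} {p₀ p : M} (hp : p ∈ (chartAt (Euc k) p₀).source)
    (hg : MDifferentiableAt (𝓡 k) 𝓘(ℝ, F) g p) (X : TangentSpace (𝓡 k) p) :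
    mfderiv (𝓡 k) 𝓘(ℝ, F) g p X = fderiv ℝ (inChart p₀ g) (chartAt (Euc k) p₀ p)
      (mfderiv (𝓡 k) (𝓡 k) (chartAt (Euc k) p₀) p X) := by
  set c := chartAt (Euc k) p₀
  have hc := mdifferentiable_chart_two (k := k) p₀
  have hcp : c p ∈ c.target := c.map_source hp
  have e : g =ᶠ[𝓝 p] (inChart p₀ g) ∘ c := by
    filter_upwards [c.open_source.mem_nhds hp] with q hq
    simp [inChart, c, c.left_inv hq]
  have h1 : MDifferentiableAt (𝓡 k) 𝓘(ℝ, F) (inChart p₀ g) (c p) := by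
    refine MDifferentiableAt.comp (c p) (I' := 𝓡 k) ?_ (hc.mdifferentiableAt_symm hcp)
    simpa [c, c.left_inv hp] using hg
  rw [e.mfderiv_eq, mfderiv_comp p h1 (hc.mdifferentiableAt hp), mfderiv_eq_fderiv]
  rfl

theorem ContMDiff.contDiffOn_inChart {g : M → F} (hg : ContMDiff (𝓡 k) 𝓘(ℝ, F) 2 g) (p₀ : M) :
    ContDiffOn ℝ 2 (inChart p₀ g) (chartAt (Euc k) p₀).target := by
  rw [← contMDiffOn_iff_contDiffOn]
  exact hg.comp_contMDiffOn contMDiffOn_chart_symm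

end Charts

/-! ### Transfer of a vanishing pullback between immersions with the same image -/

/-- Composing `g` with a linear left inverse `P` of its derivative gives a map with derivative the
identity, to which the inverse function theorem applies. The resulting `R` is differentiable in the
ambient space `W`, as later chain rules require. -/
theorem exists_local_leftInverse {E W : Type*} [NormedAddCommGroup E] [NormedSpace ℝ E]
    [FiniteDimensional ℝ E] [NormedAddCommGroup W] [NormedSpace ℝ W] [FiniteDimensional ℝ W]
    {g : E → W} {x₀ : E}
    (hg : ContDiffAt ℝ 1 g x₀) (hinj : Function.Injective (fderiv ℝ g x₀)) :
    ∃ R : W → E, ∀ᶠ x in 𝓝 x₀, R (g x) = x ∧ DifferentiableAt ℝ R (g x) := by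
  obtain ⟨P₀, hP₀⟩ := (fderiv ℝ g x₀).toLinearMap.exists_leftInverse_of_injective
    (LinearMap.ker_eq_bot.2 hinj)
  set P : W →L[ℝ] E := LinearMap.toContinuousLinearMap P₀
  have hP : P ∘L fderiv ℝ g x₀ = ContinuousLinearMap.id ℝ E :=
    ContinuousLinearMap.ext fun x => LinearMap.congr_fun hP₀ x
  have h1 : ContDiffAt ℝ 1 (P ∘ g) x₀ := P.contDiff.contDiffAt.comp x₀ hg
  have h2 : HasFDerivAt (P ∘ g) ((ContinuousLinearEquiv.refl ℝ E : E →L[ℝ] E)) x₀ := by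
    have := P.hasFDerivAt.comp x₀ (hg.differentiableAt (by norm_num)).hasFDerivAt
    rw [hP] at this
    exact this
  have h3 : HasStrictFDerivAt (P ∘ g) ((ContinuousLinearEquiv.refl ℝ E : E →L[ℝ] E)) x₀ :=
    h1.hasStrictFDerivAt' h2 (by norm_num)
  refine ⟨h1.localInverse h2 (by norm_num) ∘ P, ?_⟩
  have h4 : ∀ᶠ y in 𝓝 ((P ∘ g) x₀), DifferentiableAt ℝ (h1.localInverse h2 (by norm_num)) y := by
    have := h1.to_localInverse h2 (by norm_num)
    filter_upwards [this.eventually (by simp)] with y hy using hy.differentiableAt (by norm_num)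
  filter_upwards [h3.eventually_left_inverse, h1.continuousAt.eventually h4] with x hx hx'
  exact ⟨hx, hx'.comp (g x) P.differentiableAt⟩

section Transfer

variable {W : Type*} [NormedAddCommGroup W] [NormedSpace ℝ W]
  {k m : ℕ} {M N : Type*} [TopologicalSpace M] [ChartedSpace (Euc k) M]
  [TopologicalSpace N] [ChartedSpace (Euc m) N] [IsManifold (𝓡 m) 2 N]

theorem IsC2Immersion.exists_local_retraction [FiniteDimensional ℝ W] {g : N → W}
    (hg : IsC2Immersion (𝓡 m) 𝓘(ℝ, W) g)
    (q : N) : ∃ R : W → N, ∀ᶠ x in 𝓝 q, R (g x) = x ∧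
      MDifferentiableAt 𝓘(ℝ, W) (𝓡 m) R (g x) := by
  set c := chartAt (Euc m) q
  have hc := mdifferentiable_chart_two (k := m) q
  have hq : q ∈ c.source := mem_chart_source _ q
  have h1 : ContDiffAt ℝ 2 (inChart q g) (c q) :=
    (hg.contMDiff.contDiffOn_inChart q).contDiffAt (c.open_target.mem_nhds (c.map_source hq))
  have hinj : Function.Injective (fderiv ℝ (inChart q g) (c q)) := by
    intro X Y hXY
    obtain ⟨X, rfl⟩ := hc.mfderiv_surjective hq X
    obtain ⟨Y, rfl⟩ := hc.mfderiv_surjective hq Y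
    have hd := (hg.contMDiff q).mdifferentiableAt (by norm_num : (2 : WithTop ℕ∞) ≠ 0)
    have := hg.injective_mfderiv q (a₁ := X) (a₂ := Y) (by
      rw [mfderiv_eq_fderiv_inChart hq hd X, mfderiv_eq_fderiv_inChart hq hd Y]
      exact hXY)
    rw [this]
  obtain ⟨R, hR⟩ := exists_local_leftInverse (h1.of_le (by norm_num)) hinj
  refine ⟨c.symm ∘ R, ?_⟩
  filter_upwards [(c.continuousAt hq).eventually hR, c.open_source.mem_nhds hq] with x hx hxs
  have e : inChart q g (c x) = g x := by simp [inChart, c, c.left_inv hxs]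
  rw [e] at hx
  refine ⟨by simp [hx.1, c.left_inv hxs], ?_⟩
  refine MDifferentiableAt.comp (g x) (I' := 𝓡 m) ?_ hx.2.mdifferentiableAt
  rw [hx.1]
  exact hc.mdifferentiableAt_symm (c.map_source hxs)

/-- A set-theoretic lift of `f` through `g` may be discontinuous, so the chain rule is not available
everywhere. Baire's theorem on `M` provides a dense open set on which `f` factors locally and
differentiably through `g`. -/
theorem dense_setOf_range_mfderiv_le [FiniteDimensional ℝ W] [T2Space M]
    [SecondCountableTopology N] {f : M → W} {g : N → W}
    (hf : ContMDiff (𝓡 k) 𝓘(ℝ, W) 2 f) (hg : IsC2Immersion (𝓡 m) 𝓘(ℝ, W) g)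
    (hfg : range f ⊆ range g) :
    Dense {p : M | ∃ q : N, ∀ X : TangentSpace (𝓡 k) p, ∃ Y : TangentSpace (𝓡 m) q,
      (mfderiv (𝓡 k) 𝓘(ℝ, W) f p X : W) = mfderiv (𝓡 m) 𝓘(ℝ, W) g q Y} := by
  have := ChartedSpace.locallyCompactSpace (Euc k) M
  have := ChartedSpace.locallyCompactSpace (Euc m) N
  choose R hR using hg.exists_local_retraction
  -- Compactness makes each `g '' K q` closed, and second countability of `N` leaves countably many
  -- of them: the closed cover that Baire's theorem needs.
  have hK : ∀ q : N, ∃ K ∈ 𝓝 q, K ⊆ {x | R q (g x) = x ∧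
      MDifferentiableAt 𝓘(ℝ, W) (𝓡 m) (R q) (g x)} ∧ IsCompact K := fun q =>
    local_compact_nhds (hR q)
  choose K hKn hKs hKc using hK
  obtain ⟨s, hs, hsu⟩ := TopologicalSpace.countable_cover_nhds hKn
  have hcl : ∀ q ∈ s, IsClosed (f ⁻¹' (g '' K q)) := fun q _ =>
    ((hKc q).image hg.contMDiff.continuous).isClosed.preimage hf.continuous
  have hun : ⋃ q ∈ s, f ⁻¹' (g '' K q) = univ := by
    refine eq_univ_of_forall fun p => ?_
    obtain ⟨y, hy⟩ := hfg (mem_range_self p)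
    have : y ∈ ⋃ x ∈ s, K x := hsu ▸ mem_univ y
    simp only [mem_iUnion] at this ⊢
    obtain ⟨q, hq, hyq⟩ := this
    exact ⟨q, hq, y, hyq, hy⟩
  refine (dense_biUnion_interior_of_closed hcl hs hun).mono ?_
  intro p hp
  simp only [mem_iUnion] at hp
  obtain ⟨q, hq, hpq⟩ := hp
  have hnear : ∀ᶠ p' in 𝓝 p, p' ∈ f ⁻¹' (g '' K q) := mem_interior_iff_mem_nhds.1 hpq
  have heq : f =ᶠ[𝓝 p] fun p' => g (R q (f p')) := by
    filter_upwards [hnear] with p' hp'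
    obtain ⟨y, hy, hyp⟩ := hp'
    rw [← hyp, (hKs q hy).1]
  obtain ⟨y, hy, hyp⟩ := hnear.self_of_nhds
  refine ⟨R q (f p), fun X => ⟨mfderiv (𝓡 k) (𝓡 m) (R q ∘ f) p X, ?_⟩⟩
  have hRd : MDifferentiableAt 𝓘(ℝ, W) (𝓡 m) (R q) (f p) := hyp ▸ (hKs q hy).2
  have hfd := (hf p).mdifferentiableAt (by norm_num : (2 : WithTop ℕ∞) ≠ 0)
  have hgd := (hg.contMDiff (R q (f p))).mdifferentiableAt (by norm_num : (2 : WithTop ℕ∞) ≠ 0)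
  have h := mfderiv_comp p (f := R q ∘ f) (g := g) hgd (hRd.comp p hfd)
  rw [heq.mfderiv_eq]
  exact congrArg (fun L => L X) h

/-- In a fixed chart the derivative of `f` depends continuously on the point, so a nonzero value on
two fixed coordinate vectors persists nearby. Together with the density above, this extends the
vanishing to all of `M`. -/
theorem isClosed_setOf_forall_mfderiv_eq_zero [IsManifold (𝓡 k) 2 M] {f : M → W}
    (hf : ContMDiff (𝓡 k) 𝓘(ℝ, W) 2 f)
    {σ : W → W → ℝ} (hσ : Continuous fun z : W × W => σ z.1 z.2) :
    IsClosed {p : M | ∀ X Y : TangentSpace (𝓡 k) p,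
      σ (mfderiv (𝓡 k) 𝓘(ℝ, W) f p X) (mfderiv (𝓡 k) 𝓘(ℝ, W) f p Y) = 0} := by
  refine isClosed_of_closure_subset fun p₀ hp₀ => ?_
  set c := chartAt (Euc k) p₀
  have hc := mdifferentiable_chart_two (k := k) p₀
  have hp : p₀ ∈ c.source := mem_chart_source _ p₀
  have hd : ∀ p, MDifferentiableAt (𝓡 k) 𝓘(ℝ, W) f p := fun p =>
    (hf p).mdifferentiableAt (by norm_num : (2 : WithTop ℕ∞) ≠ 0)
  have hcont : ContinuousAt (fun p => fderiv ℝ (inChart p₀ f) (c p)) p₀ := by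
    refine ContinuousAt.comp (g := fderiv ℝ (inChart p₀ f)) ?_ (c.continuousAt hp)
    exact ((hf.contDiffOn_inChart p₀).continuousOn_fderiv_of_isOpen c.open_target
      (by norm_num)).continuousAt (c.open_target.mem_nhds (c.map_source hp))
  intro X Y
  rw [mfderiv_eq_fderiv_inChart hp (hd _) X, mfderiv_eq_fderiv_inChart hp (hd _) Y]
  set X' : Euc k := mfderiv (𝓡 k) (𝓡 k) (chartAt (Euc k) p₀) p₀ X
  set Y' : Euc k := mfderiv (𝓡 k) (𝓡 k) (chartAt (Euc k) p₀) p₀ Y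
  by_contra hne
  have hcσ : ContinuousAt (fun p => σ (fderiv ℝ (inChart p₀ f) (c p) X')
      (fderiv ℝ (inChart p₀ f) (c p) Y')) p₀ :=
    ContinuousAt.comp (g := fun z : W × W => σ z.1 z.2) hσ.continuousAt
      ((hcont.clm_apply continuousAt_const).prodMk (hcont.clm_apply continuousAt_const))
  have hev := hcσ.eventually_ne hne
  obtain ⟨p, hpA, hpne, hps⟩ := ((mem_closure_iff_frequently.1 hp₀).and_eventually
    (hev.and (c.open_source.mem_nhds hp))).exists
  obtain ⟨X₁, hX₁⟩ := hc.mfderiv_surjective hps X'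
  obtain ⟨Y₁, hY₁⟩ := hc.mfderiv_surjective hps Y'
  apply hpne
  have := hpA X₁ Y₁
  rw [mfderiv_eq_fderiv_inChart hps (hd _) X₁, mfderiv_eq_fderiv_inChart hps (hd _) Y₁] at this
  rw [← hX₁, ← hY₁]
  exact this

/-- If the image of `f` lies in the image of the immersion `g` and a continuous two-form with
constant coefficients pulls back to zero along `g`, then it pulls back to zero along `f`. -/
theorem pullback_eq_zero_of_range_subset [FiniteDimensional ℝ W] [IsManifold (𝓡 k) 2 M]
    [T2Space M] [SecondCountableTopology N]
    {f : M → W} {g : N → W}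
    (hf : ContMDiff (𝓡 k) 𝓘(ℝ, W) 2 f) (hg : IsC2Immersion (𝓡 m) 𝓘(ℝ, W) g)
    (hfg : range f ⊆ range g) {σ : W → W → ℝ} (hσ : Continuous fun z : W × W => σ z.1 z.2)
    (h : ∀ (q : N) (X Y : TangentSpace (𝓡 m) q),
      σ (mfderiv (𝓡 m) 𝓘(ℝ, W) g q X) (mfderiv (𝓡 m) 𝓘(ℝ, W) g q Y) = 0)
    (p : M) (X Y : TangentSpace (𝓡 k) p) :
    σ (mfderiv (𝓡 k) 𝓘(ℝ, W) f p X) (mfderiv (𝓡 k) 𝓘(ℝ, W) f p Y) = 0 := by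
  have hcl := isClosed_setOf_forall_mfderiv_eq_zero hf hσ
  have hd := (dense_setOf_range_mfderiv_le hf hg hfg).mono (s₂ := {p : M |
    ∀ X Y : TangentSpace (𝓡 k) p,
      σ (mfderiv (𝓡 k) 𝓘(ℝ, W) f p X) (mfderiv (𝓡 k) 𝓘(ℝ, W) f p Y) = 0}) (by
    rintro p ⟨q, hq⟩ X Y
    obtain ⟨X', hX⟩ := hq X
    obtain ⟨Y', hY⟩ := hq Y
    have := h q X' Y'
    rw [← hX, ← hY] at this
    exact this)
  have : p ∈ closure {p : M | ∀ X Y : TangentSpace (𝓡 k) p,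
      σ (mfderiv (𝓡 k) 𝓘(ℝ, W) f p X) (mfderiv (𝓡 k) 𝓘(ℝ, W) f p Y) = 0} := hd p
  rw [hcl.closure_eq] at this
  exact this X Y

end Transfer

/-! ### The one-form `⟪a, db⟫` on a vector space and its exterior derivative -/

section PairForm

variable {E F : Type*} [NormedAddCommGroup E] [NormedSpace ℝ E]
  [NormedAddCommGroup F] [InnerProductSpace ℝ F]

/-- The one-form `⟪a, db⟫`. -/
noncomputable def pairForm (a b : E → F) (x : E) : E →L[ℝ] ℝ := (innerSL ℝ (a x)) ∘L (fderiv ℝ b x)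

/-- The two-form `d⟪a, db⟫` vanishes at `x`. -/
def PairClosedAt (a b : E → F) (x : E) : Prop :=
  ∀ X Y : E, (inner ℝ (fderiv ℝ a x X) (fderiv ℝ b x Y) : ℝ) =
    inner ℝ (fderiv ℝ a x Y) (fderiv ℝ b x X)

theorem hasFDerivAt_pairForm {a b : E → F} {x : E} (ha : DifferentiableAt ℝ a x)
    (hb : ContDiffAt ℝ 2 b x) :
    ∃ L : E →L[ℝ] E →L[ℝ] ℝ, HasFDerivAt (pairForm a b) L x ∧ ∀ X Y, L X Y =
      inner ℝ (a x) (fderiv ℝ (fderiv ℝ b) x X Y) + inner ℝ (fderiv ℝ a x X) (fderiv ℝ b x Y) := by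
  have h2 : DifferentiableAt ℝ (fderiv ℝ b) x :=
    (hb.fderiv_right (m := 1) (by norm_num)).differentiableAt (by norm_num)
  have h1 : HasFDerivAt (fun y => innerSL ℝ (a y)) ((innerSL ℝ).comp (fderiv ℝ a x)) x :=
    (innerSL ℝ).hasFDerivAt.comp x ha.hasFDerivAt
  refine ⟨_, h1.clm_comp h2.hasFDerivAt, fun X Y => ?_⟩
  simp

/-- The term `⟪a, D²b⟫` is symmetric and cancels, leaving only `⟪da, db⟫`. -/
theorem fderiv_pairForm_symm_iff {a b : E → F} {x : E} (ha : DifferentiableAt ℝ a x)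
    (hb : ContDiffAt ℝ 2 b x) :
    (∀ X Y, fderiv ℝ (pairForm a b) x X Y = fderiv ℝ (pairForm a b) x Y X) ↔
      PairClosedAt a b x := by
  obtain ⟨L, hL, hLe⟩ := hasFDerivAt_pairForm ha hb
  have hs : IsSymmSndFDerivAt ℝ b x := hb.isSymmSndFDerivAt (by simp)
  rw [hL.fderiv]
  refine forall₂_congr fun X Y => ?_
  rw [hLe, hLe, hs.eq X Y, add_right_inj]

theorem pairClosedAt_of_eventually_hasFDerivAt {a b : E → F} {x : E} {f : E → ℝ}
    (ha : DifferentiableAt ℝ a x) (hb : ContDiffAt ℝ 2 b x)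
    (hf : ∀ᶠ y in 𝓝 x, HasFDerivAt f (pairForm a b y) y) : PairClosedAt a b x := by
  obtain ⟨L, hL, -⟩ := hasFDerivAt_pairForm ha hb
  rw [← fderiv_pairForm_symm_iff ha hb, hL.fderiv]
  exact second_derivative_symmetric_of_eventually hf hL

theorem exists_primitive_pairForm {a b : E → F} {s : Set E} (hs : IsOpen s) (hc : Convex ℝ s)
    (ha : DifferentiableOn ℝ a s) (hb : ContDiffOn ℝ 2 b s) (h : ∀ x ∈ s, PairClosedAt a b x) :
    ∃ f : E → ℝ, ∀ x ∈ s, HasFDerivAt f (pairForm a b x) x := by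
  have ha' : ∀ x ∈ s, DifferentiableAt ℝ a x := fun x hx => ha.differentiableAt (hs.mem_nhds hx)
  have hb' : ∀ x ∈ s, ContDiffAt ℝ 2 b x := fun x hx => hb.contDiffAt (hs.mem_nhds hx)
  refine hc.exists_forall_hasFDerivAt_of_fderiv_symmetric hs (fun x hx => ?_) fun x hx =>
    (fderiv_pairForm_symm_iff (ha' x hx) (hb' x hx)).2 (h x hx)
  obtain ⟨L, hL, -⟩ := hasFDerivAt_pairForm (ha' x hx) (hb' x hx)
  exact hL.differentiableAt.differentiableWithinAt

theorem contDiffOn_of_hasFDerivAt_pairForm {a b : E → F} {s : Set E} (hs : IsOpen s)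
    (ha : ContDiffOn ℝ 1 a s) (hb : ContDiffOn ℝ 2 b s) {f : E → ℝ}
    (h : ∀ x ∈ s, HasFDerivAt f (pairForm a b x) x) : ContDiffOn ℝ 2 f s := by
  rw [show (2 : WithTop ℕ∞) = 1 + 1 by norm_num, contDiffOn_succ_iff_fderiv_of_isOpen hs]
  refine ⟨fun x hx => (h x hx).differentiableAt.differentiableWithinAt, by simp, ?_⟩
  refine ContDiffOn.congr (f := pairForm a b) ?_ fun x hx => (h x hx).fderiv
  exact ((innerSL ℝ).contDiff.comp_contDiffOn ha).clm_comp
    (hb.fderiv_of_isOpen hs (by norm_num))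

theorem inner_fderiv_eq_zero_of_norm_eq_one {a : E → F} {x : E} (ha : DifferentiableAt ℝ a x)
    (h1 : ∀ y, ‖a y‖ = 1) (X : E) : (inner ℝ (a x) (fderiv ℝ a x X) : ℝ) = 0 := by
  have h := fderiv_inner_apply ℝ ha ha X
  have hc : (fun y => (inner ℝ (a y) (a y) : ℝ)) = fun _ => 1 := by
    funext y
    rw [real_inner_self_eq_norm_sq, h1 y, one_pow]
  rw [hc] at h
  simp only [fderiv_fun_const, Pi.zero_apply, zero_apply] at h
  rw [real_inner_comm (fderiv ℝ a x X)] at h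
  rw [real_inner_comm]
  linarith [real_inner_comm (a x) (fderiv ℝ a x X)]

/-- The standard symplectic pairing on `F × F`. -/
noncomputable def stdSymp (X Y : F × F) : ℝ := inner ℝ X.1 Y.2 - inner ℝ Y.1 X.2

theorem continuous_stdSymp : Continuous fun z : (F × F) × (F × F) => stdSymp z.1 z.2 := by
  unfold stdSymp
  fun_prop

/-- Projecting `b` off `a` adds to its differential multiples of `a`, which are orthogonal to `da`,
and a multiple of `da`, whose pairing with `da` is symmetric. Neither survives antisymmetrization.
-/
theorem stdSymp_fderiv_line {a b : E → F} {x : E} (ha : DifferentiableAt ℝ a x)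
    (hb : DifferentiableAt ℝ b x) (h1 : ∀ y, ‖a y‖ = 1) (X Y : E) :
    stdSymp (fderiv ℝ (fun y => (a y, b y - (inner ℝ (a y) (b y) : ℝ) • a y)) x X)
      (fderiv ℝ (fun y => (a y, b y - (inner ℝ (a y) (b y) : ℝ) • a y)) x Y) =
    inner ℝ (fderiv ℝ a x X) (fderiv ℝ b x Y) - inner ℝ (fderiv ℝ a x Y) (fderiv ℝ b x X) := by
  have hab := ha.inner ℝ hb
  have h := ha.hasFDerivAt.prodMk (hb.hasFDerivAt.sub (hab.hasFDerivAt.smul ha.hasFDerivAt))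
  have hX := inner_fderiv_eq_zero_of_norm_eq_one ha h1 X
  have hY := inner_fderiv_eq_zero_of_norm_eq_one ha h1 Y
  have e := h.fderiv
  simp only [Pi.sub_def, Pi.smul_def'] at e
  rw [e]
  rw [real_inner_comm] at hX hY
  simp [stdSymp, inner_sub_right, inner_add_right, inner_smul_right, hX, hY,
    real_inner_comm (fderiv ℝ a x X) (fderiv ℝ a x Y)]

end PairForm

/-! ### Isotropy as closedness of the dual one-form -/

section CurlFree

variable {n k : ℕ} {M : Type*} [TopologicalSpace M] [ChartedSpace (Euc k) M]

/-- The one-form dual to `v` for the induced metric is closed: the differential of `v` is symmetric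
on each tangent space. -/
def UnitTangentField.IsCurlFree {ι : M → Euc (n + 1)} (v : UnitTangentField k ι) : Prop :=
  ∀ (p : M) (X Y : TangentSpace (𝓡 k) p),
    (inner ℝ (dEuc k v.toFun p X) (dEuc k ι p Y) : ℝ) =
      inner ℝ (dEuc k v.toFun p Y) (dEuc k ι p X)

theorem ContMDiff.mdifferentiable_two {F : Type*} [NormedAddCommGroup F] [NormedSpace ℝ F]
    {g : M → F} (hg : ContMDiff (𝓡 k) 𝓘(ℝ, F) 2 g) : MDifferentiable (𝓡 k) 𝓘(ℝ, F) g :=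
  hg.mdifferentiable (by norm_num)

variable [IsManifold (𝓡 k) 2 M]

theorem ContMDiff.contDiffAt_inChart {F : Type*} [NormedAddCommGroup F] [NormedSpace ℝ F]
    {g : M → F} (hg : ContMDiff (𝓡 k) 𝓘(ℝ, F) 2 g) {p₀ p : M}
    (hp : p ∈ (chartAt (Euc k) p₀).source) :
    ContDiffAt ℝ 2 (inChart p₀ g) (chartAt (Euc k) p₀ p) :=
  (hg.contDiffOn_inChart p₀).contDiffAt ((chartAt (Euc k) p₀).open_target.mem_nhds
    ((chartAt (Euc k) p₀).map_source hp))

theorem dEuc_eq_fderiv_inChart {g : M → Euc (n + 1)}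
    (hg : ContMDiff (𝓡 k) 𝓘(ℝ, Euc (n + 1)) 2 g) {p₀ p : M}
    (hp : p ∈ (chartAt (Euc k) p₀).source) (X : TangentSpace (𝓡 k) p) :
    dEuc k g p X = fderiv ℝ (inChart p₀ g) (chartAt (Euc k) p₀ p)
      (mfderiv (𝓡 k) (𝓡 k) (chartAt (Euc k) p₀) p X) :=
  mfderiv_eq_fderiv_inChart hp (hg.mdifferentiable_two p) X

theorem pairClosedAt_inChart_iff {a b : M → Euc (n + 1)}
    (ha : ContMDiff (𝓡 k) 𝓘(ℝ, Euc (n + 1)) 2 a) (hb : ContMDiff (𝓡 k) 𝓘(ℝ, Euc (n + 1)) 2 b)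
    {p₀ p : M}
    (hp : p ∈ (chartAt (Euc k) p₀).source) :
    PairClosedAt (inChart p₀ a) (inChart p₀ b) (chartAt (Euc k) p₀ p) ↔
      ∀ X Y : TangentSpace (𝓡 k) p, (inner ℝ (dEuc k a p X) (dEuc k b p Y) : ℝ) =
        inner ℝ (dEuc k a p Y) (dEuc k b p X) := by
  have hv := dEuc_eq_fderiv_inChart ha hp
  have hi := dEuc_eq_fderiv_inChart hb hp
  have hs := (mdifferentiable_chart_two (k := k) p₀).mfderiv_surjective hp
  constructor
  · intro h X Y
    rw [hv X, hv Y, hi X, hi Y]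
    exact h _ _
  · intro h X Y
    obtain ⟨X, rfl⟩ := hs X
    obtain ⟨Y, rfl⟩ := hs Y
    have := h X Y
    rw [hv X, hv Y, hi X, hi Y] at this
    exact this

variable {ι : M → Euc (n + 1)} {v : UnitTangentField k ι}

namespace UnitTangentField

theorem IsCurlFree.pairClosedAt (h : v.IsCurlFree)
    (hι : ContMDiff (𝓡 k) 𝓘(ℝ, Euc (n + 1)) 2 ι) (p₀ : M) {x : Euc k}
    (hx : x ∈ (chartAt (Euc k) p₀).target) :
    PairClosedAt (inChart p₀ v.toFun) (inChart p₀ ι) x := by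
  have := (pairClosedAt_inChart_iff v.contMDiff hι ((chartAt (Euc k) p₀).map_target hx)).2 (h _)
  rwa [(chartAt (Euc k) p₀).right_inv hx] at this

theorem isCurlFree_iff_stdSymp (hι : ContMDiff (𝓡 k) 𝓘(ℝ, Euc (n + 1)) 2 ι)
    (hΦ : ContMDiff (𝓡 k) 𝓘(ℝ, Euc (n + 1) × Euc (n + 1)) 2
      (fun p => (v.lineMap p : Euc (n + 1) × Euc (n + 1)))) :
    v.IsCurlFree ↔ ∀ (p : M) (X Y : TangentSpace (𝓡 k) p),
      stdSymp (mfderiv (𝓡 k) 𝓘(ℝ, Euc (n + 1) × Euc (n + 1))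
          (fun p => (v.lineMap p : Euc (n + 1) × Euc (n + 1))) p X)
        (mfderiv (𝓡 k) 𝓘(ℝ, Euc (n + 1) × Euc (n + 1))
          (fun p => (v.lineMap p : Euc (n + 1) × Euc (n + 1))) p Y) = 0 := by
  refine forall_congr' fun p => forall₂_congr fun X Y => ?_
  have hp : p ∈ (chartAt (Euc k) p).source := mem_chart_source _ p
  have h := stdSymp_fderiv_line
    ((v.contMDiff.contDiffAt_inChart hp).differentiableAt (by norm_num))
    ((hι.contDiffAt_inChart hp).differentiableAt (by norm_num))
    (fun y => v.norm_eq_one _) (mfderiv (𝓡 k) (𝓡 k) (chartAt (Euc k) p) p X)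
    (mfderiv (𝓡 k) (𝓡 k) (chartAt (Euc k) p) p Y)
  rw [mfderiv_eq_fderiv_inChart hp (hΦ.mdifferentiable_two p) X,
    mfderiv_eq_fderiv_inChart hp (hΦ.mdifferentiable_two p) Y]
  rw [dEuc_eq_fderiv_inChart v.contMDiff hp X, dEuc_eq_fderiv_inChart v.contMDiff hp Y,
    dEuc_eq_fderiv_inChart hι hp X, dEuc_eq_fderiv_inChart hι hp Y]
  refine sub_eq_zero.symm.trans (Eq.congr_left ?_)
  exact h.symm

theorem isIsotropic_iff_isCurlFree {m : ℕ} [T2Space M] [SecondCountableTopology M]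
    (hι : ContMDiff (𝓡 k) 𝓘(ℝ, Euc (n + 1)) 2 ι)
    (hΦ : IsC2Immersion (𝓡 k) 𝓘(ℝ, Euc (n + 1) × Euc (n + 1))
      (fun p => (v.lineMap p : Euc (n + 1) × Euc (n + 1))))
    {N : Type*} [TopologicalSpace N] [T2Space N] [SecondCountableTopology N]
    [ChartedSpace (Euc m) N] [IsManifold (𝓡 m) 2 N] {j : N → TSphere n}
    (hj : IsC2Immersion (𝓡 m) 𝓘(ℝ, Euc (n + 1) × Euc (n + 1))
      (fun q => (j q : Euc (n + 1) × Euc (n + 1))))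
    (hrange : range j = range v.lineMap) : IsIsotropic m j ↔ v.IsCurlFree := by
  have hr : range (fun q => (j q : Euc (n + 1) × Euc (n + 1))) =
      range (fun p => (v.lineMap p : Euc (n + 1) × Euc (n + 1))) := by
    rw [show (fun q => (j q : Euc (n + 1) × Euc (n + 1))) = Subtype.val ∘ j from rfl,
      show (fun p => (v.lineMap p : Euc (n + 1) × Euc (n + 1))) = Subtype.val ∘ v.lineMap from rfl,
      range_comp, range_comp, hrange]
  rw [isCurlFree_iff_stdSymp hι hΦ.contMDiff]
  have hiso : IsIsotropic m j ↔ ∀ (q : N) (X Y : TangentSpace (𝓡 m) q),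
      stdSymp (mfderiv (𝓡 m) 𝓘(ℝ, Euc (n + 1) × Euc (n + 1))
          (fun x => (j x : Euc (n + 1) × Euc (n + 1))) q X)
        (mfderiv (𝓡 m) 𝓘(ℝ, Euc (n + 1) × Euc (n + 1))
          (fun x => (j x : Euc (n + 1) × Euc (n + 1))) q Y) = 0 := by
    refine forall_congr' fun q => forall₂_congr fun X Y => ?_
    exact Eq.congr_left (symplecticForm_apply n _ _ _)
  rw [hiso]
  -- Both maps are immersions, so the transfer applies in each direction with the roles exchanged.
  exact ⟨fun h => pullback_eq_zero_of_range_subset hΦ.contMDiff hj hr.ge continuous_stdSymp h,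
    fun h => pullback_eq_zero_of_range_subset hj.contMDiff hΦ hr.le continuous_stdSymp h⟩

end UnitTangentField

end CurlFree

/-! ### Gluing local potentials -/

/-- On a simply connected space, local functions which differ by locally constant functions can be
glued, up to additive constants, to a global function. -/
theorem exists_glue_of_simplyConnected {X G : Type*} [TopologicalSpace X] [SimplyConnectedSpace X]
    [LocallyPathConnectedSpace X] [AddCommGroup G] (U : X → Set X) (hU : ∀ x, IsOpen (U x))
    (hxU : ∀ x, x ∈ U x) (f : X → X → G)
    (hf : ∀ a b, ∀ x ∈ U a ∩ U b, ∀ᶠ y in 𝓝 x, f a y - f b y = f a x - f b x) :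
    ∃ g : X → G, ∀ x, ∃ c : G, ∀ᶠ y in 𝓝 x, g y = f x y + c := by
  -- With discrete fibre `G`, the additive constants form a bundle with locally constant transition
  -- functions `f a - f b`, that is, a covering; simple connectedness gives it a global section.
  let _ : TopologicalSpace G := ⊥
  have : DiscreteTopology G := ⟨rfl⟩
  let Z : FiberBundleCore X X G :=
    { baseSet := U
      isOpen_baseSet := hU
      indexAt := id
      mem_baseSet_at := hxU
      coordChange := fun a b x c => f a x - f b x + c
      coordChange_self := by simp
      continuousOn_coordChange := by
        rintro a b ⟨x, c⟩ ⟨hx, -⟩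
        refine ContinuousAt.continuousWithinAt ?_
        have h : ∀ᶠ z : X × G in 𝓝 (x, c), f a z.1 - f b z.1 + z.2 = f a x - f b x + c := by
          rw [nhds_prod_eq, nhds_discrete G]
          filter_upwards [(hf a b x hx).prod_mk (Filter.mem_pure.2 rfl : ∀ᶠ z in pure c, z = c)]
            with z hz
          rw [hz.1, hz.2]
        exact continuousAt_const.congr (h.mono fun z hz => hz.symm)
      coordChange_comp := by
        intros
        abel }
  obtain ⟨a₀⟩ : Nonempty X := inferInstance
  have hcov : IsCoveringMap Z.proj := FiberBundle.isCoveringMap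
  obtain ⟨s, ⟨-, hs⟩, -⟩ := hcov.existsUnique_continuousMap_lifts (ContinuousMap.id X) a₀
    (⟨a₀, (0 : G)⟩ : Z.TotalSpace) rfl
  have hs' : ∀ x, (s x).1 = x := fun x => congrFun hs x
  let t : X → G := fun x => (s x).2
  -- Read in the trivialization at `x`, the section is `f y y - f x y + t y`. It is locally constant
  -- with value `t x` at `x`, so the glued function is `f x + t x` near `x`.
  refine ⟨fun x => f x x + t x, fun x => ⟨t x, ?_⟩⟩
  have h1 : ContinuousAt (fun y => (Z.localTriv x (s y)).2) x := by
    refine continuous_snd.continuousAt.comp (ContinuousAt.comp ?_ s.continuous.continuousAt)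
    refine (Z.localTriv x).continuousAt ?_
    have : Z.proj (s x) ∈ U x := by
      rw [show Z.proj (s x) = x from hs' x]
      exact hxU x
    exact this
  have h2 : ∀ y, (Z.localTriv x (s y)).2 = f y y - f x y + t y := by
    intro y
    have : (Z.localTriv x (s y)).2 = f (s y).1 (s y).1 - f x (s y).1 + t y := rfl
    rw [this, hs' y]
  simp only [h2] at h1
  have h3 := h1.eventually (mem_nhds_discrete.2 (mem_singleton _))
  filter_upwards [h3] with y hy
  have hy' : f y y - f x y + t y = f x x - f x x + t x := hy
  rw [sub_self, zero_add] at hy'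
  rw [← hy']
  abel

/-! ### Local and global potentials of `v` -/

namespace UnitTangentField

variable {n k : ℕ} {M : Type*} [TopologicalSpace M] [ChartedSpace (Euc k) M]
  {ι : M → Euc (n + 1)} {v : UnitTangentField k ι}

theorem IsGradientOn.mdifferentiableAt {f : M → ℝ} {U : Set M} (h : v.IsGradientOn f U)
    (hU : IsOpen U) {q : M} (hq : q ∈ U) : MDifferentiableAt (𝓡 k) 𝓘(ℝ, ℝ) f q :=
  (h.1.contMDiffAt (hU.mem_nhds hq)).mdifferentiableAt (by norm_num)

variable [IsManifold (𝓡 k) 2 M]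

/-- The dictionary between gradients for the induced metric and primitives of `⟪v, dι⟫` in a chart;
the metric itself never has to be written in coordinates. -/
theorem hasFDerivAt_pairForm_inChart_iff (hι : ContMDiff (𝓡 k) 𝓘(ℝ, Euc (n + 1)) 2 ι) {p₀ q : M}
    (hq : q ∈ (chartAt (Euc k) p₀).source) {f : M → ℝ}
    (hf : MDifferentiableAt (𝓡 k) 𝓘(ℝ, ℝ) f q) :
    HasFDerivAt (inChart p₀ f) (pairForm (inChart p₀ v.toFun) (inChart p₀ ι)
        (chartAt (Euc k) p₀ q)) (chartAt (Euc k) p₀ q) ↔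
      ∀ X : TangentSpace (𝓡 k) q,
        (mfderiv (𝓡 k) 𝓘(ℝ, ℝ) f q X : ℝ) = inner ℝ (v.toFun q) (dEuc k ι q X) := by
  set c := chartAt (Euc k) p₀
  have hc := mdifferentiable_chart_two (k := k) p₀
  have hd : DifferentiableAt ℝ (inChart p₀ f) (c q) := by
    rw [← mdifferentiableAt_iff_differentiableAt]
    refine MDifferentiableAt.comp (c q) (I' := 𝓡 k) ?_ (hc.mdifferentiableAt_symm (c.map_source hq))
    simpa [c, c.left_inv hq] using hf
  have e : ∀ X : TangentSpace (𝓡 k) q, pairForm (inChart p₀ v.toFun) (inChart p₀ ι) (c q)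
      (mfderiv (𝓡 k) (𝓡 k) c q X) = inner ℝ (v.toFun q) (dEuc k ι q X) := by
    intro X
    rw [dEuc_eq_fderiv_inChart hι hq X]
    change inner ℝ (v.toFun (c.symm (c q))) _ = _
    rw [c.left_inv hq]
    rfl
  constructor
  · intro h X
    rw [mfderiv_eq_fderiv_inChart hq hf X, h.fderiv]
    exact e X
  · intro h
    suffices pairForm (inChart p₀ v.toFun) (inChart p₀ ι) (c q) = fderiv ℝ (inChart p₀ f) (c q) by
      rw [this]
      exact hd.hasFDerivAt
    refine ContinuousLinearMap.ext fun X => ?_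
    obtain ⟨X, rfl⟩ := hc.mfderiv_surjective hq X
    rw [e X, ← h X, mfderiv_eq_fderiv_inChart hq hf X]

theorem IsGradientOn.eventually_hasFDerivAt (hι : ContMDiff (𝓡 k) 𝓘(ℝ, Euc (n + 1)) 2 ι)
    {f : M → ℝ} {U : Set M} (h : v.IsGradientOn f U) (hU : IsOpen U) {p : M} (hp : p ∈ U) :
    ∀ᶠ x in 𝓝 (chartAt (Euc k) p p), HasFDerivAt (inChart p f)
      (pairForm (inChart p v.toFun) (inChart p ι) x) x := by
  set c := chartAt (Euc k) p
  have hps : p ∈ c.source := mem_chart_source _ p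
  have h1 : ContinuousAt c.symm (c p) := c.continuousAt_symm (c.map_source hps)
  have h2 : ∀ᶠ x in 𝓝 (c p), c.symm x ∈ U := h1.eventually (by
    rw [c.left_inv hps]
    exact hU.mem_nhds hp)
  filter_upwards [h2, c.open_target.mem_nhds (c.map_source hps)] with x hx hxt
  have := (hasFDerivAt_pairForm_inChart_iff hι (c.map_target hxt)
    (h.mdifferentiableAt hU hx)).2 (h.2 _ hx)
  rwa [c.right_inv hxt] at this

theorem isCurlFree_of_locally_isGradientOn (hι : ContMDiff (𝓡 k) 𝓘(ℝ, Euc (n + 1)) 2 ι)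
    (h : ∀ p : M, ∃ U : Set M, IsOpen U ∧ p ∈ U ∧ ∃ f : M → ℝ, v.IsGradientOn f U) :
    v.IsCurlFree := by
  intro p
  obtain ⟨U, hU, hp, f, hf⟩ := h p
  have hps := mem_chart_source (Euc k) p
  rw [← pairClosedAt_inChart_iff v.contMDiff hι hps]
  exact pairClosedAt_of_eventually_hasFDerivAt
    ((v.contMDiff.contDiffAt_inChart hps).differentiableAt (by norm_num))
    (hι.contDiffAt_inChart hps) (hf.eventually_hasFDerivAt hι hU hp)

theorem IsCurlFree.exists_isGradientOn (hι : ContMDiff (𝓡 k) 𝓘(ℝ, Euc (n + 1)) 2 ι)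
    (h : v.IsCurlFree) (p : M) :
    ∃ U : Set M, IsOpen U ∧ p ∈ U ∧ ∃ f : M → ℝ, v.IsGradientOn f U := by
  set c := chartAt (Euc k) p
  have hps : p ∈ c.source := mem_chart_source _ p
  obtain ⟨r, hr, hrt⟩ := Metric.isOpen_iff.1 c.open_target (c p) (c.map_source hps)
  have hv' : ContDiffOn ℝ 2 (inChart p v.toFun) (Metric.ball (c p) r) :=
    (v.contMDiff.contDiffOn_inChart p).mono hrt
  have hι' : ContDiffOn ℝ 2 (inChart p ι) (Metric.ball (c p) r) :=
    (hι.contDiffOn_inChart p).mono hrt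
  obtain ⟨f, hf⟩ := exists_primitive_pairForm Metric.isOpen_ball (convex_ball _ _)
    (hv'.differentiableOn (by norm_num)) hι' fun x hx => h.pairClosedAt hι p (hrt hx)
  have hU : IsOpen (c.source ∩ c ⁻¹' Metric.ball (c p) r) :=
    c.isOpen_inter_preimage Metric.isOpen_ball
  have hC : ContMDiffOn (𝓡 k) 𝓘(ℝ, ℝ) 2 (f ∘ c) (c.source ∩ c ⁻¹' Metric.ball (c p) r) := by
    have h1 := contDiffOn_of_hasFDerivAt_pairForm Metric.isOpen_ball (hv'.of_le (by norm_num)) hι' hf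
    exact h1.contMDiffOn.comp (contMDiffOn_chart.mono inter_subset_left) inter_subset_right
  refine ⟨_, hU, ⟨hps, Metric.mem_ball_self hr⟩, f ∘ c, hC, fun q hq => ?_⟩
  rw [← hasFDerivAt_pairForm_inChart_iff hι hq.1
    ((hC.contMDiffAt (hU.mem_nhds hq)).mdifferentiableAt (by norm_num))]
  refine (hf _ hq.2).congr_of_eventuallyEq ?_
  filter_upwards [c.open_target.mem_nhds (c.map_source hq.1)] with x hx
  simp [inChart, c, c.right_inv hx]

theorem eventually_sub_eq_of_isGradientOn (hι : ContMDiff (𝓡 k) 𝓘(ℝ, Euc (n + 1)) 2 ι)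
    {f g : M → ℝ} {U V : Set M} (hf : v.IsGradientOn f U) (hU : IsOpen U)
    (hg : v.IsGradientOn g V) (hV : IsOpen V) {p : M} (hp : p ∈ U ∩ V) :
    ∀ᶠ q in 𝓝 p, f q - g q = f p - g p := by
  set c := chartAt (Euc k) p
  have hps : p ∈ c.source := mem_chart_source _ p
  obtain ⟨r, hr, hrs⟩ := Metric.eventually_nhds_iff_ball.1
    ((hf.eventually_hasFDerivAt hι hU hp.1).and (hg.eventually_hasFDerivAt hι hV hp.2))
  have hd : ∀ x ∈ Metric.ball (c p) r,
      HasFDerivAt (fun y => inChart p f y - inChart p g y) (0 : Euc k →L[ℝ] ℝ) x := by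
    intro x hx
    have := (hrs x hx).1.fun_sub (hrs x hx).2
    rwa [sub_self] at this
  filter_upwards [c.open_source.mem_nhds hps,
    (c.continuousAt hps).eventually (Metric.ball_mem_nhds (c p) hr)] with q hqs hq
  have := Metric.isOpen_ball.is_const_of_fderiv_eq_zero (𝕜 := ℝ)
    (convex_ball (c p) r).isPreconnected
    (fun x hx => (hd x hx).differentiableAt.differentiableWithinAt)
    (fun x hx => (hd x hx).fderiv) hq (Metric.mem_ball_self hr)
  simpa [inChart, c, c.left_inv hqs, c.left_inv hps] using this

theorem exists_isGradientOn_univ [SimplyConnectedSpace M]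
    (hι : ContMDiff (𝓡 k) 𝓘(ℝ, Euc (n + 1)) 2 ι)
    (h : ∀ p : M, ∃ U : Set M, IsOpen U ∧ p ∈ U ∧ ∃ f : M → ℝ, v.IsGradientOn f U) :
    ∃ f : M → ℝ, v.IsGradientOn f univ := by
  have := ChartedSpace.locallyPathConnectedSpace (Euc k) M
  choose U hU hpU f hf using h
  obtain ⟨g, hg⟩ := exists_glue_of_simplyConnected U hU hpU f fun a b x hx =>
    eventually_sub_eq_of_isGradientOn hι (hf a) (hU a) (hf b) (hU b) hx
  have hC : ContMDiff (𝓡 k) 𝓘(ℝ, ℝ) 2 g := by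
    intro p
    obtain ⟨a, ha⟩ := hg p
    exact (((hf p).1.contMDiffAt ((hU p).mem_nhds (hpU p))).add
      contMDiffAt_const).congr_of_eventuallyEq ha
  refine ⟨g, hC.contMDiffOn, fun p _ => ?_⟩
  obtain ⟨a, ha⟩ := hg p
  set c := chartAt (Euc k) p
  have hps : p ∈ c.source := mem_chart_source _ p
  rw [← hasFDerivAt_pairForm_inChart_iff hι hps ((hC p).mdifferentiableAt (by norm_num))]
  refine (((hf p).eventually_hasFDerivAt hι (hU p) (hpU p)).self_of_nhds.add_const
    a).congr_of_eventuallyEq ?_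
  have h1 : ContinuousAt c.symm (c p) := c.continuousAt_symm (c.map_source hps)
  exact h1.eventually (by rwa [c.left_inv hps])

end UnitTangentField

/-! ### Regular level sets -/

/-- A regular level set of a `C²` function is parametrized near a regular point by a Euclidean
space; the parametrization `i` has a differentiable left inverse. -/
theorem exists_levelSet_parametrization {k : ℕ} {f : Euc k → ℝ} {x₀ : Euc k} {s : Set (Euc k)}
    (hs : s ∈ 𝓝 x₀) (hf : ContDiffAt ℝ 2 f x₀) {V : Euc k} (hV : fderiv ℝ f x₀ V = 1) :
    ∃ (d : ℕ) (i : Euc d → Euc k) (R : Euc k → Euc d), d + 1 = k ∧ ContDiff ℝ 2 i ∧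
      x₀ ∈ range i ∧ ∀ u, i u ∈ s ∧ f (i u) = f x₀ ∧ R (i u) = u ∧ DifferentiableAt ℝ R (i u) := by
  set α := fderiv ℝ f x₀
  let K : Submodule ℝ (Euc k) := LinearMap.ker α.toLinearMap
  let d := Module.finrank ℝ K
  let e : K ≃ₗᵢ[ℝ] Euc d := (stdOrthonormalBasis ℝ K).repr
  let A : Euc d →ₗᵢ[ℝ] Euc k := K.subtypeₗᵢ.comp e.symm.toLinearIsometry
  let B : Euc k →L[ℝ] Euc d := (e.toContinuousLinearEquiv : K →L[ℝ] Euc d) ∘L K.orthogonalProjectionOnto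
  have hBA : ∀ u, B (A u) = u := fun u => by simp [A, B]
  have hαA : ∀ u, α (A u) = 0 := fun u => (e.symm u).2
  -- `H` has derivative the identity at `x₀`, and `α V = 1` gives `α (H x) - α x₀ = f x - f x₀`.
  -- Hence it straightens level sets of `f` into translates of `ker α`.
  let H : Euc k → Euc k := fun x => x + (f x - f x₀ - α (x - x₀)) • V
  have hHx₀ : H x₀ = x₀ := by simp [H]
  have hHd : ∀ x, DifferentiableAt ℝ f x → DifferentiableAt ℝ H x := fun x hx => by
    simp only [H]
    fun_prop
  have hHC : ContDiffAt ℝ 2 H x₀ := by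
    simp only [H]
    fun_prop
  have hH' : HasFDerivAt H ((ContinuousLinearEquiv.refl ℝ (Euc k) : Euc k →L[ℝ] Euc k)) x₀ := by
    have h1 := (hf.differentiableAt (by norm_num)).hasFDerivAt
    have h2 : HasFDerivAt (fun x => α (x - x₀)) α x₀ :=
      α.hasFDerivAt.comp x₀ ((hasFDerivAt_id x₀).sub_const x₀)
    have h3 := (hasFDerivAt_id x₀).add (((h1.sub_const (f x₀)).sub h2).smul_const V)
    refine h3.congr_fderiv ?_
    ext x
    simp [α]
  have hαH : ∀ x, α (H x) - α x₀ = f x - f x₀ := fun x => by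
    simp only [H, map_add, map_smul, map_sub, hV, smul_eq_mul]
    ring
  let E := hHC.toOpenPartialHomeomorph H hH' (by norm_num)
  have hE : ∀ x, E x = H x := fun x => rfl
  have hx₀E : x₀ ∈ E.source := hHC.mem_toOpenPartialHomeomorph_source hH' (by norm_num)
  have hx₀T : x₀ ∈ E.target := by
    have := E.map_source hx₀E
    rwa [hE, hHx₀] at this
  have hsymm : E.symm x₀ = x₀ := by
    have := E.left_inv hx₀E
    rwa [hE, hHx₀] at this
  have hψ : ContDiffAt ℝ 2 E.symm x₀ := by
    have := hHC.to_localInverse hH' (by norm_num)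
    rwa [hHx₀] at this
  have hcont : Tendsto E.symm (𝓝 x₀) (𝓝 x₀) := by
    have := hψ.continuousAt
    rwa [ContinuousAt, hsymm] at this
  have hfev : ∀ᶠ x in 𝓝 x₀, ContDiffAt ℝ 2 f x := hf.eventually (by simp)
  have hψev : ∀ᶠ x in 𝓝 x₀, ContDiffAt ℝ 2 E.symm x := hψ.eventually (by simp)
  obtain ⟨r, hr, hball⟩ := Metric.eventually_nhds_iff_ball.1
    ((hcont.eventually hs).and ((hcont.eventually hfev).and (hψev.and (E.open_target.mem_nhds hx₀T))))
  -- Rescales all of `Euc d` onto a small ball, so that the parametrization is defined on the whole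
  -- Euclidean space.
  let b := OpenPartialHomeomorph.univBall (0 : Euc d) r
  have hb : ∀ u, b u ∈ Metric.ball (0 : Euc d) r := fun u => by
    have := b.map_source (x := u) (by simp [b])
    rwa [OpenPartialHomeomorph.univBall_target _ hr] at this
  have hbA : ∀ u, x₀ + A (b u) ∈ Metric.ball x₀ r := fun u => by
    have := hb u
    simpa [A.norm_map] using this
  have hHψ : ∀ u, H (E.symm (x₀ + A (b u))) = x₀ + A (b u) := fun u =>
    E.right_inv (hball _ (hbA u)).2.2.2
  refine ⟨d, fun u => E.symm (x₀ + A (b u)), fun x => b.symm (B (H x - x₀)), ?_, ?_, ?_, ?_⟩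
  · have hα : α.toLinearMap ≠ 0 := fun h => by
      have : α.toLinearMap V = 1 := hV
      rw [h] at this
      simp at this
    have := Module.Dual.finrank_ker_add_one_of_ne_zero hα
    simpa [d, K] using this
  · refine contDiff_iff_contDiffAt.2 fun u => ?_
    refine ContDiffAt.comp (g := E.symm) u (hball _ (hbA u)).2.2.1 ?_
    exact contDiffAt_const.add (A.contDiff.comp OpenPartialHomeomorph.contDiff_univBall).contDiffAt
  · refine ⟨0, ?_⟩
    simp [b, hsymm]
  · intro u
    obtain ⟨h1, h2, h3, h4⟩ := hball _ (hbA u)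
    have hB : B (H (E.symm (x₀ + A (b u))) - x₀) = b u := by
      rw [hHψ u, add_sub_cancel_left, hBA]
    refine ⟨h1, ?_, ?_, ?_⟩
    · have := hαH (E.symm (x₀ + A (b u)))
      rw [hHψ u, map_add, hαA] at this
      linarith
    · dsimp only
      rw [hB]
      exact b.left_inv (by simp [b])
    · have hbd : DifferentiableAt ℝ b.symm (B (H (E.symm (x₀ + A (b u))) - x₀)) := by
        rw [hB]
        exact ((OpenPartialHomeomorph.contDiffOn_univBall_symm (n := 1)).contDiffAt
          (Metric.isOpen_ball.mem_nhds (hb u))).differentiableAt (by norm_num)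
      exact hbd.comp (E.symm (x₀ + A (b u)))
        (B.differentiableAt.comp _ ((hHd _ (h2.differentiableAt (by norm_num))).sub_const x₀))

/-! ### Integrability of `v^⊥` and the geodesic condition -/

namespace UnitTangentField

variable {n k : ℕ} {M : Type*} [TopologicalSpace M] [ChartedSpace (Euc k) M]
  {ι : M → Euc (n + 1)} {v : UnitTangentField k ι}

theorem mem_perp_iff {p : M} {X : TangentSpace (𝓡 k) p} :
    X ∈ v.perp p ↔ (inner ℝ (v.toFun p) (dEuc k ι p X) : ℝ) = 0 := Iff.rfl

theorem finrank_perp_add_one (v : UnitTangentField k ι) (p : M) :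
    Module.finrank ℝ (v.perp p) + 1 = k := by
  obtain ⟨V, hV⟩ := v.tangent p
  have hV' : dEuc k ι p V = v.toFun p := hV
  have hne : ((innerSL ℝ (v.toFun p)).comp (dEuc k ι p)).toLinearMap ≠ 0 := fun h => by
    have h1 : (inner ℝ (v.toFun p) (dEuc k ι p V) : ℝ) = 0 := LinearMap.congr_fun h V
    rw [hV', real_inner_self_eq_norm_sq, v.norm_eq_one] at h1
    norm_num at h1
  have : FiniteDimensional ℝ (TangentSpace (𝓡 k) p) := inferInstanceAs (FiniteDimensional ℝ (Euc k))
  have := Module.Dual.finrank_ker_add_one_of_ne_zero hne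
  have hk : Module.finrank ℝ (TangentSpace (𝓡 k) p) = k := finrank_euclideanSpace_fin
  rwa [hk] at this

theorem isGeodesic_iff : v.IsGeodesic ↔ ∀ (p : M) (V Y : TangentSpace (𝓡 k) p),
    dEuc k ι p V = v.toFun p → (inner ℝ (dEuc k v.toFun p V) (dEuc k ι p Y) : ℝ) = 0 := by
  constructor
  · intro h p V Y hV
    have h1 := (Submodule.starProjection_apply_eq_zero_iff _).1 (h p V hV)
    rw [real_inner_comm]
    exact (Submodule.mem_orthogonal _ _).1 h1 _ ⟨Y, rfl⟩
  · intro h p V hV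
    refine (Submodule.starProjection_apply_eq_zero_iff _).2 ((Submodule.mem_orthogonal _ _).2 ?_)
    rintro _ ⟨Y, rfl⟩
    rw [real_inner_comm]
    exact h p V Y hV

variable [IsManifold (𝓡 k) 2 M]

theorem inner_dEuc_eq_zero (p : M) (X : TangentSpace (𝓡 k) p) :
    (inner ℝ (dEuc k v.toFun p X) (v.toFun p) : ℝ) = 0 := by
  have hp := mem_chart_source (Euc k) p
  have h := inner_fderiv_eq_zero_of_norm_eq_one
    ((v.contMDiff.contDiffAt_inChart hp).differentiableAt (by norm_num))
    (fun y => v.norm_eq_one _) (mfderiv (𝓡 k) (𝓡 k) (chartAt (Euc k) p) p X)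
  rw [← dEuc_eq_fderiv_inChart v.contMDiff hp X, real_inner_comm] at h
  simpa using h

theorem IsCurlFree.isGeodesic (h : v.IsCurlFree) : v.IsGeodesic :=
  isGeodesic_iff.2 fun p V Y hV => by rw [h p V Y, hV, inner_dEuc_eq_zero]

/-- The integral manifolds are level sets of a local potential `f`, which is regular because `df`
takes the value `‖v‖² = 1` on `v`. -/
theorem IsCurlFree.perpIntegrable (hι : ContMDiff (𝓡 k) 𝓘(ℝ, Euc (n + 1)) 2 ι)
    (h : v.IsCurlFree) : v.PerpIntegrable := by
  intro p
  obtain ⟨U, hU, hpU, f, hf⟩ := h.exists_isGradientOn hι p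
  set c := chartAt (Euc k) p
  have hc := mdifferentiable_chart_two (k := k) p
  have hps : p ∈ c.source := mem_chart_source _ p
  have hfp := (hf.1.contMDiffAt (hU.mem_nhds hpU))
  have hfC : ContDiffAt ℝ 2 (inChart p f) (c p) := by
    rw [← contMDiffAt_iff_contDiffAt]
    refine ContMDiffAt.comp (c p) (I' := 𝓡 k) ?_
      (contMDiffOn_chart_symm.contMDiffAt (c.open_target.mem_nhds (c.map_source hps)))
    rwa [c.left_inv hps]
  obtain ⟨V, hV⟩ := v.tangent p
  have hV' : dEuc k ι p V = v.toFun p := hV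
  have hV1 : fderiv ℝ (inChart p f) (c p) (mfderiv (𝓡 k) (𝓡 k) c p V) = 1 := by
    have h1 := hf.2 p hpU V
    rw [mfderiv_eq_fderiv_inChart hps (hf.mdifferentiableAt hU hpU) V, hV',
      real_inner_self_eq_norm_sq, v.norm_eq_one, one_pow] at h1
    exact h1
  have hs : c.target ∩ c.symm ⁻¹' U ∈ 𝓝 (c p) := by
    refine (c.isOpen_inter_preimage_symm hU).mem_nhds ⟨c.map_source hps, ?_⟩
    simpa [c.left_inv hps] using hpU
  obtain ⟨d, i, R, hd, hi, ⟨u₀, hu₀⟩, hiR⟩ := exists_levelSet_parametrization hs hfC hV1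
  have hiC : ContMDiff (𝓡 d) (𝓡 k) 2 (c.symm ∘ i) := fun u =>
    (contMDiffOn_chart_symm.contMDiffAt (c.open_target.mem_nhds (hiR u).1.1)).comp u
      hi.contMDiff.contMDiffAt
  have hiD : MDifferentiable (𝓡 d) (𝓡 k) (c.symm ∘ i) := hiC.mdifferentiable (by norm_num)
  have hRi : ∀ u, (R ∘ c) ((c.symm ∘ i) u) = u := fun u => by
    simp [c.right_inv (hiR u).1.1, (hiR u).2.2.1]
  have hinj : ∀ u, Function.Injective (mfderiv (𝓡 d) (𝓡 k) (c.symm ∘ i) u) := fun u => by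
    have hRd : MDifferentiableAt (𝓡 k) (𝓡 d) (R ∘ c) ((c.symm ∘ i) u) := by
      refine MDifferentiableAt.comp _ (I' := 𝓡 k) ?_
        (hc.mdifferentiableAt (c.map_target (hiR u).1.1))
      have : c ((c.symm ∘ i) u) = i u := c.right_inv (hiR u).1.1
      rw [this]
      exact (hiR u).2.2.2.mdifferentiableAt
    have h1 := mfderiv_comp u hRd (hiD u)
    rw [show (R ∘ c) ∘ (c.symm ∘ i) = id from funext hRi, mfderiv_id] at h1
    intro X Y hXY
    have hX : X = (mfderiv (𝓡 k) (𝓡 d) (R ∘ c) ((c.symm ∘ i) u))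
        (mfderiv (𝓡 d) (𝓡 k) (c.symm ∘ i) u X) := congrArg (fun L => L X) h1
    have hY : Y = (mfderiv (𝓡 k) (𝓡 d) (R ∘ c) ((c.symm ∘ i) u))
        (mfderiv (𝓡 d) (𝓡 k) (c.symm ∘ i) u Y) := congrArg (fun L => L Y) h1
    rw [hX, hY, hXY]
  refine ⟨d, Euc d, inferInstance, inferInstance, inferInstance, inferInstance, c.symm ∘ i,
    ⟨⟨hiC, hinj⟩, fun u w huw => ?_⟩, ⟨u₀, by simp [hu₀, c.left_inv hps]⟩, fun u => ?_⟩
  · rw [← hRi u, huw, hRi w]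
  · have : FiniteDimensional ℝ (TangentSpace (𝓡 k) ((c.symm ∘ i) u)) :=
      inferInstanceAs (FiniteDimensional ℝ (Euc k))
    -- Constancy of `f` along the parametrization puts the tangent space inside `ker df = v^⊥`; both
    -- have dimension `k - 1`.
    refine Submodule.eq_of_le_of_finrank_eq ?_ ?_
    · rintro _ ⟨Y, rfl⟩
      rw [mem_perp_iff]
      have h1 := mfderiv_comp u (hf.mdifferentiableAt hU (hiR u).1.2) (hiD u)
      have h2 : f ∘ (c.symm ∘ i) = fun _ => inChart p f (c p) := funext fun w => (hiR w).2.1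
      rw [h2, mfderiv_const] at h1
      exact (hf.2 _ (hiR u).1.2 _).symm.trans (congrArg (fun L => L Y) h1).symm
    · have h1 := v.finrank_perp_add_one ((c.symm ∘ i) u)
      have h2 : Module.finrank ℝ (LinearMap.range
          (mfderiv (𝓡 d) (𝓡 k) (c.symm ∘ i) u).toLinearMap) = d :=
        (LinearMap.finrank_range_of_inj (hinj u)).trans finrank_euclideanSpace_fin
      rw [h2]
      omega

theorem isCurlFree_of_perpIntegrable (hι : ContMDiff (𝓡 k) 𝓘(ℝ, Euc (n + 1)) 2 ι)
    (hperp : v.PerpIntegrable) (hgeo : v.IsGeodesic) : v.IsCurlFree := by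
  intro p X Y
  have hsymm : ∀ X ∈ v.perp p, ∀ Y ∈ v.perp p,
      (inner ℝ (dEuc k v.toFun p X) (dEuc k ι p Y) : ℝ) =
        inner ℝ (dEuc k v.toFun p Y) (dEuc k ι p X) := by
    obtain ⟨d, L, _, _, _, _, i, hi, ⟨q, rfl⟩, hT⟩ := hperp p
    have hiD : MDifferentiable (𝓡 d) (𝓡 k) i := hi.contMDiff.mdifferentiable (by norm_num)
    have hcomp : ∀ {g : M → Euc (n + 1)}, ContMDiff (𝓡 k) 𝓘(ℝ, Euc (n + 1)) 2 g →
        ∀ (y : L) (Z : TangentSpace (𝓡 d) y),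
          dEuc d (g ∘ i) y Z = dEuc k g (i y) (mfderiv (𝓡 d) (𝓡 k) i y Z) := fun hg y Z =>
      congrArg (fun T => T Z) (mfderiv_comp y (hg.mdifferentiable_two (i y)) (hiD y))
    have ha := v.contMDiff.comp hi.contMDiff
    have hb := hι.comp hi.contMDiff
    have hz : ∀ (y : L) (Z : TangentSpace (𝓡 d) y),
        (inner ℝ ((v.toFun ∘ i) y) (dEuc d (ι ∘ i) y Z) : ℝ) = 0 := fun y Z => by
      rw [hcomp hι]
      refine mem_perp_iff.1 ?_
      rw [← hT y]
      exact ⟨Z, rfl⟩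
    have hq := mem_chart_source (Euc d) q
    have hclosed : PairClosedAt (inChart q (v.toFun ∘ i)) (inChart q (ι ∘ i))
        (chartAt (Euc d) q q) := by
      -- The form `⟪v, dι⟫` pulls back to zero on the leaf, so the zero function is a primitive
      -- there.
      refine pairClosedAt_of_eventually_hasFDerivAt (f := fun _ => 0)
        ((ha.contDiffAt_inChart hq).differentiableAt (by norm_num)) (hb.contDiffAt_inChart hq) ?_
      filter_upwards [(chartAt (Euc d) q).open_target.mem_nhds
        ((chartAt (Euc d) q).map_source hq)] with x hx
      suffices pairForm (inChart q (v.toFun ∘ i)) (inChart q (ι ∘ i)) x = 0 by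
        rw [this]
        exact hasFDerivAt_const _ _
      have hy := (chartAt (Euc d) q).map_target hx
      refine ContinuousLinearMap.ext fun Z => ?_
      obtain ⟨Z, rfl⟩ := (mdifferentiable_chart_two (k := d) q).mfderiv_surjective hy Z
      have h1 := hz _ Z
      rw [dEuc_eq_fderiv_inChart hb hy Z, (chartAt (Euc d) q).right_inv hx] at h1
      exact h1
    intro X hX Y hY
    rw [← hT q] at hX hY
    obtain ⟨X, rfl⟩ := hX
    obtain ⟨Y, rfl⟩ := hY
    have h1 := (pairClosedAt_inChart_iff ha hb hq).1 hclosed X Y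
    rw [hcomp v.contMDiff, hcomp v.contMDiff, hcomp hι, hcomp hι] at h1
    exact h1
  obtain ⟨V, hV⟩ := v.tangent p
  have hV' : dEuc k ι p V = v.toFun p := hV
  have hdec : ∀ X : TangentSpace (𝓡 k) p, ∃ X₁ ∈ v.perp p, ∃ t : ℝ, X = X₁ + t • V := fun X => by
    -- Orthogonal splitting along `v`. In the bilinear expansion `⟪dv V, ·⟫` vanishes since `v` is
    -- geodesic, `⟪dv ·, v⟫` since `v` has unit length.
    refine ⟨X - (inner ℝ (v.toFun p) (dEuc k ι p X) : ℝ) • V, ?_, _, (sub_add_cancel _ _).symm⟩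
    rw [mem_perp_iff, map_sub, map_smul, hV', inner_sub_right, inner_smul_right,
      real_inner_self_eq_norm_sq, v.norm_eq_one]
    ring
  obtain ⟨X, hX, s, rfl⟩ := hdec X
  obtain ⟨Y, hY, t, rfl⟩ := hdec Y
  have hVg := fun Z => isGeodesic_iff.1 hgeo p V Z hV'
  simp only [map_add, map_smul, inner_add_left, inner_add_right, inner_smul_left, inner_smul_right,
    hVg, hV', inner_dEuc_eq_zero, hsymm X hX Y hY]
  simp

end UnitTangentField

theorem theorem1 {n k m : ℕ}
    {M : Type*} [TopologicalSpace M] [SecondCountableTopology M]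
    [ChartedSpace (Euc k) M] [IsManifold (𝓡 k) 2 M]
    (ι : M → Euc (n + 1))
    (hι : IsImmersedSubmanifold (𝓡 k) 𝓘(ℝ, Euc (n + 1)) ι)
    (v : UnitTangentField k ι)
    (hΦ : IsC2Immersion (𝓡 k) 𝓘(ℝ, Euc (n + 1) × Euc (n + 1))
      (fun p => (v.lineMap p : Euc (n + 1) × Euc (n + 1))))
    {N : Type*} [TopologicalSpace N] [SecondCountableTopology N]
    [ChartedSpace (Euc m) N] [IsManifold (𝓡 m) 2 N]
    (j : N → TSphere n)
    (hj : IsImmersedSubmanifold (𝓡 m) 𝓘(ℝ, Euc (n + 1) × Euc (n + 1))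
      (fun q => (j q : Euc (n + 1) × Euc (n + 1))))
    (hrange : range j = range v.lineMap) :
    List.TFAE
      [IsIsotropic m j,
       (∀ p : M, ∃ U : Set M, IsOpen U ∧ p ∈ U ∧ ∃ f : M → ℝ, v.IsGradientOn f U) ∧
         (SimplyConnectedSpace M → ∃ f : M → ℝ, v.IsGradientOn f univ),
       v.PerpIntegrable ∧ v.IsGeodesic] := by
  have : T2Space M := T2Space.of_injective_continuous hι.injective hι.contMDiff.continuous
  have : T2Space N := T2Space.of_injective_continuous hj.injective hj.contMDiff.continuous
  rw [UnitTangentField.isIsotropic_iff_isCurlFree hι.contMDiff hΦ hj.toIsC2Immersion hrange]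
  tfae_have 1 → 2 := fun h =>
    ⟨h.exists_isGradientOn hι.contMDiff, fun _ =>
      UnitTangentField.exists_isGradientOn_univ hι.contMDiff
        (h.exists_isGradientOn hι.contMDiff)⟩
  tfae_have 2 → 1 := fun h =>
    UnitTangentField.isCurlFree_of_locally_isGradientOn hι.contMDiff h.1
  tfae_have 1 → 3 := fun h => ⟨h.perpIntegrable hι.contMDiff, h.isGeodesic⟩
  tfae_have 3 → 1 := fun h =>
    UnitTangentField.isCurlFree_of_perpIntegrable hι.contMDiff h.1 h.2
  tfae_finish
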